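/- Let $p$ be an odd prime, let $n,k$ be positive integers with $n\nmid k$, put $e=\gcd(n,k)$ and $d=(p^k+1)/2$, and let $f(x)=x^d$ on the finite field $\mathbb{F}_{p^n}$. Let $$\Delta_f=\max_{a\in\mathbb{F}_{p^n}\setminus\{0\},\ b\in\mathbb{F}_{p^n}}\bigl|\{x\in\mathbb{F}_{p^n}: f(x+a)-f(x)=b\}\bigr|$$ be the differential uniformity of $f$. Then $$\Delta_f=\begin{cases}\dfrac{p^e-1}{2}, & \text{if } k/e \text{ is odd},\\[2mm] p^e+1, & \text{if } k/e \text{ is even}.\end{cases}$$ In particular, $\Delta_f\le\gcd\bigl(\tfrac{p^k-1}{2},\,p^{2n}-1\bigr)$. -/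

import Mathlib

/-- The number `N(a, b)` of solutions `x` of `f (x + a) - f x = b`. -/
noncomputable def diffCount {F : Type*} [Field F] (f : F → F) (a b : F) : ℕ :=
  Nat.card {x : F // f (x + a) - f x = b}

open Classical in
/-- The differential uniformity of `f`: the maximum of `N(a, b)` over all nonzero `a` and all `b`. -/
noncomputable def differentialUniformity {F : Type*} [Field F] [Fintype F] (f : F → F) : ℕ :=
  (Finset.univ.filter (fun ab : F × F => ab.1 ≠ 0)).sup (fun ab => diffCount f ab.1 ab.2)

/-! Write `q` for the order of `F` and `m = (p^k - 1)/2`. Substituting `x = a (y - 1)^2 / (4 y)`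
turns `f (x + a) - f x` into a constant times `y^m + y^(-m)`, and `x` lies in `F` exactly when
`y^(q-1) = 1` or `y^(q+1) = 1`. Solutions thus correspond to pairs `{y, y⁻¹}` with `y^m = z` for a
fixed `z`, up to inverting `y`. Each group of roots of unity contributes a coset of size `gcd(m, q ∓
1)` or nothing. This gives the maximum of the two gcds as upper bound (`card_le_max_gcd`), and a gcd
is attained at a `z` with `z^2 ≠ 1`. What remains is to evaluate the gcds. -/

open Polynomial

/-! ### Fibres of power maps on roots of unity -/

/-- The `N`-th roots of unity in `K` whose `m`-th power is `z`. -/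
noncomputable def powFiber (K : Type*) [Field K] (N m : ℕ) (z : K) : Finset K :=
  open Classical in (nthRootsFinset N (1 : K)).filter (fun y => y ^ m = z)

theorem mem_powFiber {K : Type*} [Field K] {N m : ℕ} (hN : 0 < N) {z y : K} :
    y ∈ powFiber K N m z ↔ y ^ N = 1 ∧ y ^ m = z := by
  classical
  simp [powFiber, mem_nthRootsFinset hN]

theorem card_powFiber_le {K : Type*} [Field K] {N : ℕ} (hN : 0 < N) (m : ℕ) (z : K) :
    (powFiber K N m z).card ≤ m.gcd N := by
  classical
  rcases (powFiber K N m z).eq_empty_or_nonempty with h | ⟨y₀, h₀⟩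
  · simp [h]
  have hg : 0 < m.gcd N := Nat.gcd_pos_of_pos_right m hN
  rw [mem_powFiber hN] at h₀
  have hy₀ : y₀ ≠ 0 := by
    rintro rfl
    simp [hN.ne'] at h₀
  refine le_trans (Finset.card_le_card_of_injOn (fun y => y / y₀)
    (t := nthRootsFinset (m.gcd N) (1 : K)) (fun y hy => ?_) (fun y _ y' _ h => ?_)) ?_
  · have hy := (mem_powFiber hN).1 (Finset.mem_coe.1 hy)
    have hz : z ≠ 0 := h₀.2 ▸ pow_ne_zero _ hy₀
    rw [Finset.mem_coe, mem_nthRootsFinset hg]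
    refine pow_gcd_eq_one.2 ⟨?_, ?_⟩
    · rw [div_pow, hy.2, h₀.2, div_self hz]
    · rw [div_pow, hy.1, h₀.1, div_self one_ne_zero]
  · exact (div_left_inj' hy₀).1 h
  · rw [nthRootsFinset_def]
    exact (Multiset.toFinset_card_le _).trans (card_nthRoots _ _)

theorem le_card_powFiber {K : Type*} [Field K] {N m : ℕ} (hN : 0 < N) {y₀ ζ : K}
    (hy₀ : y₀ ^ N = 1) (hζ : IsPrimitiveRoot ζ N) :
    m.gcd N ≤ (powFiber K N m (y₀ ^ m)).card := by
  classical
  have hg : 0 < m.gcd N := Nat.gcd_pos_of_pos_right m hN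
  obtain ⟨c, hc⟩ := Nat.gcd_dvd_right m N
  have hprim : IsPrimitiveRoot (ζ ^ c) (m.gcd N) := hζ.pow hN (by rw [mul_comm]; exact hc)
  have hy : y₀ ≠ 0 := by
    rintro rfl
    simp [hN.ne'] at hy₀
  rw [← hprim.card_nthRootsFinset]
  refine Finset.card_le_card_of_injOn (fun y => y₀ * y) (fun y h => ?_)
    (fun y _ y' _ h => mul_left_cancel₀ hy h)
  rw [Finset.mem_coe, mem_nthRootsFinset hg] at h
  have := pow_gcd_eq_one.1 h
  simp [mem_powFiber hN, mul_pow, hy₀, this.1, this.2]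

theorem add_inv_eq_add_inv_iff {K : Type*} [Field K] {y z : K} (hy : y ≠ 0) (hz : z ≠ 0) :
    y + y⁻¹ = z + z⁻¹ ↔ y = z ∨ y = z⁻¹ := by
  constructor
  · intro h
    have h' : (y - z) * (y - z⁻¹) = 0 := by
      field_simp at h ⊢
      linear_combination h
    rcases mul_eq_zero.1 h' with h | h
    · exact Or.inl (sub_eq_zero.1 h)
    · exact Or.inr (sub_eq_zero.1 h)
  · rintro (rfl | rfl)
    · rfl
    · rw [inv_inv, add_comm]

/-- If `z^2 ≠ 1`, only one of the two fibres is nonempty. If `z^2 = 1`, both are closed under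
inversion, so `y + y⁻¹` is two-to-one on their disjoint sum and the bound is the average of the
gcds. -/
theorem card_le_max_gcd {K : Type*} [Field K] {N m : ℕ} (hN : 0 < N) (z : K)
    (S : Finset K)
    (hS : ∀ w ∈ S, ∃ y, y + y⁻¹ = w ∧ y ^ m = z ∧ (y ^ N = 1 ∨ y ^ (N + 2) = 1)) :
    S.card ≤ max (m.gcd N) (m.gcd (N + 2)) := by
  classical
  have hN' : 0 < N + 2 := by omega
  set A := powFiber K N m z with hA
  set B := powFiber K (N + 2) m z with hB
  have cA : A.card ≤ m.gcd N := card_powFiber_le hN m z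
  have cB : B.card ≤ m.gcd (N + 2) := card_powFiber_le hN' m z
  have mA : ∀ y, y ∈ A ↔ y ^ N = 1 ∧ y ^ m = z := fun y => mem_powFiber hN
  have mB : ∀ y, y ∈ B ↔ y ^ (N + 2) = 1 ∧ y ^ m = z := fun y => mem_powFiber hN'
  by_cases hz : z ^ 2 = 1
  · let u : K ⊕ K → K := fun s => Sum.elim id id s + (Sum.elim id id s)⁻¹
    have hinv : ∀ y : K, y ^ m = z → y⁻¹ ^ m = z := by
      intro y hy
      rw [inv_pow, hy]
      exact inv_eq_of_mul_eq_one_left (by rw [← sq, hz])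
    have hsub : S ⊆ (A.disjSum B).image u := by
      intro w hw
      obtain ⟨y, rfl, hy, h | h⟩ := hS w hw
      · exact Finset.mem_image.2 ⟨Sum.inl y, by simp [mA, h, hy], rfl⟩
      · exact Finset.mem_image.2 ⟨Sum.inr y, by simp [mB, h, hy], rfl⟩
    -- A self-inverse `y` lies in both fibres, so the disjoint sum still counts it twice.
    have hself : ∀ y : K, y⁻¹ = y → (y ^ N = 1 ∨ y ^ (N + 2) = 1) →
        y ^ N = 1 ∧ y ^ (N + 2) = 1 := by
      intro y hy h
      have hy0 : y ≠ 0 := by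
        rintro rfl
        simp [hN.ne'] at h
      have hy2 : y ^ 2 = 1 := by
        rw [sq]
        nth_rewrite 1 [← hy]
        exact inv_mul_cancel₀ hy0
      simpa [pow_add, hy2] using h
    have hfib : ∀ w ∈ (A.disjSum B).image u, 2 ≤ ((A.disjSum B).filter (fun s => u s = w)).card := by
      intro w hw
      obtain ⟨s, hs, rfl⟩ := Finset.mem_image.1 hw
      rw [Nat.succ_le_iff, Finset.one_lt_card]
      rcases s with y | y
      · have hy := (mA y).1 (by simpa using hs)
        by_cases h : y⁻¹ = y
        · have := hself y h (Or.inl hy.1)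
          exact ⟨Sum.inl y, Finset.mem_filter.2 ⟨hs, rfl⟩, Sum.inr y,
            Finset.mem_filter.2 ⟨by simp [mB, this.2, hy.2], rfl⟩, by simp⟩
        · refine ⟨Sum.inl y, Finset.mem_filter.2 ⟨hs, rfl⟩, Sum.inl y⁻¹,
            Finset.mem_filter.2 ⟨?_, by simp [u, add_comm]⟩, by simpa using Ne.symm h⟩
          have := hinv y hy.2
          rw [inv_pow] at this
          simp [mA, hy.1, this]
      · have hy := (mB y).1 (by simpa using hs)
        by_cases h : y⁻¹ = y
        · have := hself y h (Or.inr hy.1)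
          exact ⟨Sum.inr y, Finset.mem_filter.2 ⟨hs, rfl⟩, Sum.inl y,
            Finset.mem_filter.2 ⟨by simp [mA, this.1, hy.2], rfl⟩, by simp⟩
        · refine ⟨Sum.inr y, Finset.mem_filter.2 ⟨hs, rfl⟩, Sum.inr y⁻¹,
            Finset.mem_filter.2 ⟨?_, by simp [u, add_comm]⟩, by simpa using Ne.symm h⟩
          have := hinv y hy.2
          rw [inv_pow] at this
          simp [mB, hy.1, this]
    have h1 := Finset.mul_card_image_le_card (A.disjSum B) 2 hfib
    have h2 := Finset.card_le_card hsub
    rw [Finset.card_disjSum] at h1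
    omega
  · have hsub : S ⊆ (A ∪ B).image (fun y => y + y⁻¹) := by
      intro w hw
      obtain ⟨y, rfl, hy, h | h⟩ := hS w hw
      · exact Finset.mem_image.2 ⟨y, by simp [mA, h, hy], rfl⟩
      · exact Finset.mem_image.2 ⟨y, by simp [mB, h, hy], rfl⟩
    have h1 := (Finset.card_le_card hsub).trans Finset.card_image_le
    rcases A.eq_empty_or_nonempty with hA0 | ⟨y, hy⟩
    · rw [hA0, Finset.empty_union] at h1
      omega
    rcases B.eq_empty_or_nonempty with hB0 | ⟨y', hy'⟩
    · rw [hB0, Finset.union_empty] at h1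
      omega
    rw [mA] at hy
    rw [mB] at hy'
    refine absurd ?_ hz
    have e1 : z ^ N = 1 := by rw [← hy.2, ← pow_mul, mul_comm, pow_mul, hy.1, one_pow]
    have e2 : z ^ (N + 2) = 1 := by rw [← hy'.2, ← pow_mul, mul_comm, pow_mul, hy'.1, one_pow]
    rwa [pow_add, e1, one_mul] at e2

/-! ### The substitution and descent to the finite field -/

/-- Twice the exponent is `p^k + 1`, so the Frobenius expands `(y ± 1)^(p^k + 1)` as `(y^(p^k) ±
1)(y ± 1)`. -/
theorem pow_half_sub_pow_half {K : Type*} [Field K] {p : ℕ} [Fact p.Prime] [CharP K p]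
    (hp2 : p ≠ 2) (k : ℕ) {a x y : K} (hy : y ≠ 0) (hxy : 4 * (x * y) = a * (y - 1) ^ 2) :
    (x + a) ^ ((p ^ k + 1) / 2) - x ^ ((p ^ k + 1) / 2) =
      2 * (a / 4) ^ ((p ^ k + 1) / 2) *
        (y ^ ((p ^ k - 1) / 2) + (y ^ ((p ^ k - 1) / 2))⁻¹) := by
  have hodd : Odd (p ^ k) := ((Fact.out : p.Prime).odd_of_ne_two hp2).pow
  obtain ⟨m, hm⟩ := hodd
  have e1 : (p ^ k + 1) / 2 = m + 1 := by omega
  have e2 : (p ^ k - 1) / 2 = m := by omega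
  have e3 : 2 * (m + 1) = p ^ k + 1 := by omega
  have h4 : (4 : K) ≠ 0 := by
    have h2 : (2 : K) ≠ 0 := Ring.two_ne_zero (by rwa [ringChar.eq K p])
    rw [show (4 : K) = 2 * 2 by norm_num]
    exact mul_ne_zero h2 h2
  have hx : x = a / 4 * y⁻¹ * (y - 1) ^ 2 := by
    field_simp
    linear_combination hxy
  have hxa : x + a = a / 4 * y⁻¹ * (y + 1) ^ 2 := by
    field_simp
    linear_combination hxy
  rw [e1, e2, hxa, hx, mul_pow _ ((y + 1) ^ 2), mul_pow _ ((y - 1) ^ 2), ← pow_mul, ← pow_mul, e3,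
    pow_succ (y + 1), pow_succ (y - 1), add_pow_char_pow, sub_pow_char_pow, one_pow, mul_pow, hm]
  have : (y⁻¹) ^ (m + 1) * (y ^ (2 * m + 1) + y) = y ^ m + (y ^ m)⁻¹ := by
    rw [inv_pow]
    field_simp
    ring
  rw [← this]
  ring

theorem exists_algebraMap_eq_of_pow_card_eq {F K : Type*} [Field F] [Fintype F] [Field K]
    [Algebra F K] {w : K} (hw : w ^ Fintype.card F = w) : ∃ x : F, algebraMap F K x = w := by
  have hsp : (X ^ Fintype.card F - X : F[X]).Splits := by
    rw [splits_iff_card_roots, FiniteField.roots_X_pow_card_sub_X,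
      FiniteField.X_pow_card_sub_X_natDegree_eq F Fintype.one_lt_card]
    rfl
  have hne : (X ^ Fintype.card F - X : F[X]) ≠ 0 :=
    FiniteField.X_pow_card_sub_X_ne_zero F Fintype.one_lt_card
  have h := hsp.mem_range_of_isRoot (i := algebraMap F K) hne (x := w) (by simp [hw])
  simpa using h

theorem exists_add_inv_eq {K : Type*} [Field K] [IsAlgClosed K] (w : K) :
    ∃ y : K, y ≠ 0 ∧ y + y⁻¹ = w := by
  obtain ⟨y, hy⟩ := IsAlgClosed.exists_root (X ^ 2 - C w * X + 1 : K[X]) (by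
    have : (X ^ 2 - C w * X + 1 : K[X]).degree = 2 := by compute_degree!
    rw [this]; norm_num)
  have h : y ^ 2 - w * y + 1 = 0 := by simpa using hy
  have hy0 : y ≠ 0 := by
    rintro rfl
    simp at h
  refine ⟨y, hy0, ?_⟩
  field_simp
  linear_combination h

/-- `y + y⁻¹` is fixed by the Frobenius of `F` iff `y ^ (q - 1) = 1` or `y ^ (q + 1) = 1`, `q = #F`. -/
theorem add_inv_pow_card_eq_iff {F K : Type*} [Field F] [Fintype F] [Field K] [Algebra F K]
    {y : K} (hy : y ≠ 0) :
    (y + y⁻¹) ^ Fintype.card F = y + y⁻¹ ↔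
      y ^ (Fintype.card F - 1) = 1 ∨ y ^ (Fintype.card F - 1 + 2) = 1 := by
  have hQ : 1 < Fintype.card F := Fintype.one_lt_card
  have hfrob : (y + y⁻¹) ^ Fintype.card F = y ^ Fintype.card F + (y ^ Fintype.card F)⁻¹ := by
    rw [← inv_pow]
    exact map_add (FiniteField.frobeniusAlgHom F K) y y⁻¹
  have e1 : y ^ Fintype.card F = y ^ (Fintype.card F - 1) * y := by
    rw [← pow_succ]
    congr 1
    omega
  have e2 : y ^ (Fintype.card F - 1 + 2) = y ^ Fintype.card F * y := by
    rw [← pow_succ]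
    congr 1
    omega
  rw [hfrob, add_inv_eq_add_inv_iff (pow_ne_zero _ hy) hy, e2, e1]
  refine or_congr ?_ ?_
  · exact mul_eq_right₀ hy
  · exact (mul_eq_one_iff_eq_inv₀ hy).symm

/-! ### Bounds for the differential uniformity -/

section

variable {F : Type*} [Field F] [Fintype F] {p : ℕ} [Fact p.Prime] [CharP F p]

theorem diffCount_pow_half_le (K : Type*) [Field K] [Algebra F K] [IsAlgClosed K]
    (hp2 : p ≠ 2) (k : ℕ) {a : F} (ha : a ≠ 0) (b : F) :
    diffCount (fun x : F => x ^ ((p ^ k + 1) / 2)) a b ≤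
      max (((p ^ k - 1) / 2).gcd (Fintype.card F - 1))
        (((p ^ k - 1) / 2).gcd (Fintype.card F - 1 + 2)) := by
  classical
  set m := (p ^ k - 1) / 2 with hm
  have : CharP K p := charP_of_injective_algebraMap (algebraMap F K).injective p
  obtain ⟨i, hi⟩ : ∃ i : F →+* K, i = algebraMap F K := ⟨_, rfl⟩
  have h2 : (2 : K) ≠ 0 := Ring.two_ne_zero (by rwa [ringChar.eq K p])
  have h4 : (4 : K) ≠ 0 := by
    rw [show (4 : K) = 2 * 2 by norm_num]
    exact mul_ne_zero h2 h2
  have hia : i a ≠ 0 := (map_ne_zero i).2 ha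
  have hpar : ∀ x : F, ∃ y : K, y ≠ 0 ∧ y + y⁻¹ = 4 * i x / i a + 2 ∧
      (y ^ (Fintype.card F - 1) = 1 ∨ y ^ (Fintype.card F - 1 + 2) = 1) ∧
      i ((x + a) ^ ((p ^ k + 1) / 2) - x ^ ((p ^ k + 1) / 2)) =
        2 * (i a / 4) ^ ((p ^ k + 1) / 2) * (y ^ m + (y ^ m)⁻¹) := by
    intro x
    obtain ⟨y, hy, hyx⟩ := exists_add_inv_eq (4 * i x / i a + 2)
    refine ⟨y, hy, hyx, ?_, ?_⟩
    · rw [← add_inv_pow_card_eq_iff (F := F) hy, hyx]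
      have : 4 * i x / i a + 2 = i (4 * x / a + 2) := by simp [map_ofNat]
      rw [this, ← map_pow, FiniteField.pow_card]
    · rw [map_sub, map_pow, map_pow, map_add]
      refine pow_half_sub_pow_half hp2 k hy ?_
      field_simp at hyx
      linear_combination -hyx
  rw [diffCount, Nat.card_eq_fintype_card, Fintype.card_subtype]
  set S := Finset.univ.filter (fun x : F => (x + a) ^ ((p ^ k + 1) / 2) - x ^ ((p ^ k + 1) / 2) = b)
    with hS
  rcases S.eq_empty_or_nonempty with h0 | ⟨x₀, hx₀⟩
  · simp [h0]
  obtain ⟨y₀, hy₀, -, -, hb₀⟩ := hpar x₀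
  rw [(Finset.mem_filter.1 hx₀).2] at hb₀
  have hinj : Function.Injective (fun x : F => 4 * i x / i a + 2) := by
    intro x x' h
    have h' : 4 * i x / i a = 4 * i x' / i a := add_right_cancel h
    exact i.injective (mul_left_cancel₀ h4 ((div_left_inj' hia).1 h'))
  rw [← Finset.card_image_of_injective S hinj]
  refine card_le_max_gcd (Nat.sub_pos_of_lt Fintype.one_lt_card) (y₀ ^ m) _ (fun w hw => ?_)
  obtain ⟨x, hx, rfl⟩ := Finset.mem_image.1 hw
  obtain ⟨y, hy, hyx, hyN, hb⟩ := hpar x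
  rw [(Finset.mem_filter.1 hx).2, hb₀] at hb
  have hc : 2 * (i a / 4) ^ ((p ^ k + 1) / 2) ≠ 0 :=
    mul_ne_zero h2 (pow_ne_zero _ (div_ne_zero hia h4))
  rcases (add_inv_eq_add_inv_iff (pow_ne_zero m hy₀) (pow_ne_zero m hy)).1
    (mul_left_cancel₀ hc hb) with h | h
  · exact ⟨y, hyx, h.symm, hyN⟩
  -- Inverting `y` leaves `x` unchanged and brings `y^m` to the common value.
  · refine ⟨y⁻¹, by rw [inv_inv, add_comm, hyx], by rw [inv_pow, h], ?_⟩
    simpa using hyN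

theorem exists_le_diffCount_pow_half (K : Type*) [Field K] [Algebra F K] [IsAlgClosed K]
    (hp2 : p ≠ 2) (k : ℕ) {N : ℕ}
    (hN : N = Fintype.card F - 1 ∨ N = Fintype.card F - 1 + 2)
    (hNm : ¬ N ∣ 2 * ((p ^ k - 1) / 2)) :
    ∃ b : F, ((p ^ k - 1) / 2).gcd N ≤ diffCount (fun x : F => x ^ ((p ^ k + 1) / 2)) 1 b := by
  classical
  set m := (p ^ k - 1) / 2 with hm
  have : CharP K p := charP_of_injective_algebraMap (algebraMap F K).injective p
  obtain ⟨i, hi⟩ : ∃ i : F →+* K, i = algebraMap F K := ⟨_, rfl⟩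
  have h2 : (2 : K) ≠ 0 := Ring.two_ne_zero (by rwa [ringChar.eq K p])
  have h4 : (4 : K) ≠ 0 := by
    rw [show (4 : K) = 2 * 2 by norm_num]
    exact mul_ne_zero h2 h2
  have hQ : 1 < Fintype.card F := Fintype.one_lt_card
  have hN0 : 0 < N := by omega
  have hcard : ((Fintype.card F : ℕ) : K) = 0 := by
    rw [← map_natCast i, FiniteField.cast_card_eq_zero, map_zero]
  -- `N` is `±1` modulo `p`, so primitive `N`-th roots of unity exist.
  have : NeZero (N : K) := ⟨by
    rcases hN with h | h
    · rw [h, Nat.cast_sub hQ.le, hcard]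
      simp
    · rw [h, show Fintype.card F - 1 + 2 = Fintype.card F + 1 by omega]
      push_cast
      rw [hcard]
      simp⟩
  obtain ⟨ζ, hζ⟩ := HasEnoughRootsOfUnity.exists_primitiveRoot K N
  have hz : (ζ ^ m) ^ 2 ≠ 1 := by
    rw [← pow_mul, mul_comm]
    exact fun h => hNm (hζ.dvd_of_pow_eq_one _ h)
  have hT : ∀ y ∈ powFiber K N m (ζ ^ m), ∃ x : F, y ≠ 0 ∧ y ^ m = ζ ^ m ∧
      y + y⁻¹ = 4 * i x + 2 := by
    intro y hy
    rw [mem_powFiber hN0] at hy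
    have hy0 : y ≠ 0 := by
      rintro rfl
      simp [hN0.ne'] at hy
    obtain ⟨x, hx⟩ := exists_algebraMap_eq_of_pow_card_eq (F := F)
      ((add_inv_pow_card_eq_iff (F := F) hy0).2 (by
        rcases hN with h | h
        · exact Or.inl (h ▸ hy.1)
        · exact Or.inr (h ▸ hy.1)))
    refine ⟨(x - 2) / 4, hy0, hy.2, ?_⟩
    rw [← hx]
    simp only [hi, map_div₀, map_sub, map_ofNat]
    field_simp
    ring
  choose! g hg using hT
  have hval : ∀ y ∈ powFiber K N m (ζ ^ m),
      i ((g y + 1) ^ ((p ^ k + 1) / 2) - g y ^ ((p ^ k + 1) / 2)) =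
        2 * (1 / 4) ^ ((p ^ k + 1) / 2) * (ζ ^ m + (ζ ^ m)⁻¹) := by
    intro y hy
    obtain ⟨hy0, hym, hyx⟩ := hg y hy
    rw [map_sub, map_pow, map_pow, map_add, map_one, ← hym]
    refine pow_half_sub_pow_half hp2 k hy0 ?_
    field_simp at hyx
    linear_combination -hyx
  have hζmem : ζ ∈ powFiber K N m (ζ ^ m) := (mem_powFiber hN0).2 ⟨hζ.pow_eq_one, rfl⟩
  refine ⟨(g ζ + 1) ^ ((p ^ k + 1) / 2) - g ζ ^ ((p ^ k + 1) / 2), ?_⟩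
  refine (le_card_powFiber hN0 hζ.pow_eq_one hζ).trans ?_
  rw [diffCount, Nat.card_eq_fintype_card, Fintype.card_subtype]
  refine Finset.card_le_card_of_injOn g (fun y hy => ?_) (fun y hy y' hy' h => ?_)
  · simp only [Finset.coe_filter, Finset.mem_univ, true_and, Set.mem_ofPred_eq]
    exact i.injective ((hval y hy).trans (hval ζ hζmem).symm)
  · obtain ⟨hy0, hym, hyx⟩ := hg y hy
    obtain ⟨hy0', hym', hyx'⟩ := hg y' hy'
    rw [h, ← hyx', add_inv_eq_add_inv_iff hy0 hy0'] at hyx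
    rcases hyx with h | h
    · exact h
    -- Two inverse elements of one fibre would force `z^2 = 1` for `z = ζ^m`.
    · refine absurd ?_ hz
      have : y * y' = 1 := by rw [h, inv_mul_cancel₀ hy0']
      calc (ζ ^ m) ^ 2 = y ^ m * y' ^ m := by rw [hym, hym', sq]
        _ = 1 := by rw [← mul_pow, this, one_pow]

theorem differentialUniformity_pow_half_le (hp2 : p ≠ 2) (k : ℕ) :
    differentialUniformity (fun x : F => x ^ ((p ^ k + 1) / 2)) ≤
      max (((p ^ k - 1) / 2).gcd (Fintype.card F - 1))
        (((p ^ k - 1) / 2).gcd (Fintype.card F - 1 + 2)) :=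
  Finset.sup_le fun ab hab =>
    diffCount_pow_half_le (AlgebraicClosure F) hp2 k (by simpa using hab) ab.2

theorem gcd_le_differentialUniformity_pow_half (hp2 : p ≠ 2) (k : ℕ) {N : ℕ}
    (hN : N = Fintype.card F - 1 ∨ N = Fintype.card F - 1 + 2)
    (hNm : ¬ N ∣ 2 * ((p ^ k - 1) / 2)) :
    ((p ^ k - 1) / 2).gcd N ≤ differentialUniformity (fun x : F => x ^ ((p ^ k + 1) / 2)) := by
  classical
  obtain ⟨b, hb⟩ := exists_le_diffCount_pow_half (AlgebraicClosure F) hp2 k hN hNm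
  refine hb.trans ?_
  exact Finset.le_sup (f := fun ab : F × F =>
    diffCount (fun x : F => x ^ ((p ^ k + 1) / 2)) ab.1 ab.2) (b := (1, b)) (by simp)

end

/-! ### Arithmetic of the gcds -/

theorem half_pow_sub_one_eq {P t : ℕ} (hP : Odd P) (ht : Odd t) :
    ∃ S, Odd S ∧ (P ^ t - 1) / 2 = (P - 1) / 2 * S := by
  obtain ⟨c, rfl⟩ := hP
  refine ⟨∑ i ∈ Finset.range t, (2 * c + 1) ^ i, ?_, ?_⟩
  · rw [Finset.odd_sum_iff_odd_card_odd]
    rw [Finset.filter_true_of_mem fun i _ => Odd.pow ⟨c, rfl⟩]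
    simpa using ht
  · have h : 2 * c * ∑ i ∈ Finset.range t, (2 * c + 1) ^ i = (2 * c + 1) ^ t - 1 := by
      have := geom_sum_mul_add (2 * c) t
      rw [mul_comm]
      omega
    rw [← h, Nat.add_sub_cancel, mul_assoc, Nat.mul_div_cancel_left _ two_pos,
      Nat.mul_div_cancel_left _ two_pos]

theorem two_mul_half_pow_sub_one {P : ℕ} (hP : Odd P) (t : ℕ) :
    2 * ((P ^ t - 1) / 2) = P ^ t - 1 := by
  have := hP.pow (n := t)
  obtain ⟨c, hc⟩ := this
  omega

theorem pow_two_mul_sub_one (P s : ℕ) : P ^ (2 * s) - 1 = (P ^ s + 1) * (P ^ s - 1) := by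
  have := Nat.sq_sub_sq (P ^ s) 1
  rwa [one_pow, ← pow_mul, mul_comm s 2] at this

theorem dvd_half_of_dvd_half_pow_sub_one {P s t g : ℕ} (hP : Odd P) (ht : Odd t)
    (hst : s.Coprime t) (h₁ : g ∣ (P ^ t - 1) / 2) (h₂ : g ∣ P ^ (2 * s) - 1) :
    g ∣ (P - 1) / 2 := by
  have hcop : t.gcd (2 * s) = 1 :=
    Nat.Coprime.mul_right (Nat.coprime_two_right.2 ht) hst.symm
  have h3 : g ∣ P - 1 := by
    have := Nat.dvd_gcd (h₁.trans ⟨2, by rw [mul_comm, two_mul_half_pow_sub_one hP]⟩) h₂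
    rwa [Nat.pow_sub_one_gcd_pow_sub_one, hcop, pow_one] at this
  -- The odd cofactor `S` removes the factor 2 left in `g ∣ P - 1`.
  obtain ⟨S, hS, hm⟩ := half_pow_sub_one_eq hP ht
  have h4 : 2 * ((P - 1) / 2) = P - 1 := by simpa using two_mul_half_pow_sub_one hP 1
  rw [← h4, mul_comm] at h3
  rw [hm] at h₁
  have := Nat.dvd_gcd h3 h₁
  rwa [Nat.gcd_mul_left, Nat.Coprime.gcd_eq_one (Nat.coprime_two_left.2 hS), mul_one] at this

theorem gcd_half_pow_sub_one_of_odd {P s t : ℕ} (hP : Odd P) (ht : Odd t) (hst : s.Coprime t) :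
    ((P ^ t - 1) / 2).gcd (P ^ s - 1) = (P - 1) / 2 := by
  refine Nat.dvd_antisymm (dvd_half_of_dvd_half_pow_sub_one hP ht hst (Nat.gcd_dvd_left _ _)
    ((Nat.gcd_dvd_right _ _).trans ?_)) (Nat.dvd_gcd ?_ ?_)
  · exact pow_two_mul_sub_one P s ▸ Dvd.intro_left _ rfl
  · obtain ⟨S, -, hm⟩ := half_pow_sub_one_eq hP ht
    exact hm ▸ Dvd.intro _ rfl
  · have h4 : 2 * ((P - 1) / 2) = P - 1 := by simpa using two_mul_half_pow_sub_one hP 1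
    exact (Dvd.intro_left 2 h4).trans (Nat.sub_one_dvd_pow_sub_one P s)

/-- Modulo `g` one gets `P^2 = 1`; since `s` is odd, `P^s + 1` reduces to `P + 1`. -/
theorem dvd_add_one_of_dvd_pow {P s t g : ℕ} (hP : 0 < P) (ht : Even t) (hst : s.Coprime t)
    (h₁ : g ∣ P ^ t - 1) (h₂ : g ∣ P ^ s + 1) : g ∣ P + 1 := by
  have hs : Odd s := by
    rw [← Nat.not_even_iff_odd]
    intro hs
    exact Nat.not_coprime_of_dvd_of_dvd one_lt_two hs.two_dvd ht.two_dvd hst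
  obtain ⟨r, rfl⟩ := ht.two_dvd
  have hcop : (2 * r).gcd (2 * s) = 2 := by
    rw [Nat.gcd_mul_left, Nat.Coprime.gcd_eq_one (Nat.Coprime.coprime_mul_left_right hst).symm]
  have h3 : g ∣ P ^ 2 - 1 := by
    have h := Nat.dvd_gcd h₁ (pow_two_mul_sub_one P s ▸ h₂.mul_right _ : g ∣ P ^ (2 * s) - 1)
    rwa [Nat.pow_sub_one_gcd_pow_sub_one, hcop] at h
  obtain ⟨j, rfl⟩ := hs
  have h4 : g ∣ P * (P ^ (2 * j) - 1) :=
    (h3.trans (by rw [pow_mul]; exact Nat.sub_one_dvd_pow_sub_one _ j)).mul_left P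
  have h5 : P ^ (2 * j + 1) + 1 = P * (P ^ (2 * j) - 1) + (P + 1) := by
    have : 1 ≤ P ^ (2 * j) := Nat.one_le_pow _ _ hP
    obtain ⟨x, hx⟩ := Nat.exists_eq_add_of_le this
    rw [pow_succ, hx, Nat.add_sub_cancel_left]
    ring
  rw [h5] at h₂
  exact (Nat.dvd_add_right h4).1 h₂

theorem gcd_half_pow_sub_one_of_even {P s t : ℕ} (hP : Odd P) (ht : Even t)
    (hst : s.Coprime t) : ((P ^ t - 1) / 2).gcd (P ^ s + 1) = P + 1 := by
  have hs : Odd s := by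
    rw [← Nat.not_even_iff_odd]
    intro hs
    exact Nat.not_coprime_of_dvd_of_dvd one_lt_two hs.two_dvd ht.two_dvd hst
  refine Nat.dvd_antisymm (dvd_add_one_of_dvd_pow hP.pos ht hst ((Nat.gcd_dvd_left _ _).trans
    ⟨2, by rw [mul_comm, two_mul_half_pow_sub_one hP]⟩) (Nat.gcd_dvd_right _ _))
    (Nat.dvd_gcd ?_ ?_)
  · obtain ⟨r, rfl⟩ := ht.two_dvd
    have h1 : P ^ 2 - 1 ∣ P ^ (2 * r) - 1 := by
      rw [pow_mul]
      exact Nat.sub_one_dvd_pow_sub_one _ r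
    obtain ⟨S, hS⟩ := h1
    have h2 : P ^ 2 - 1 = (P + 1) * (P - 1) := by simpa using pow_two_mul_sub_one P 1
    have h4 : 2 * ((P - 1) / 2) = P - 1 := by simpa using two_mul_half_pow_sub_one hP 1
    refine ⟨(P - 1) / 2 * S, ?_⟩
    rw [hS, h2, ← h4]
    refine Nat.div_eq_of_eq_mul_right two_pos ?_
    rw [Nat.mul_div_cancel_left _ two_pos]
    ring
  · simpa using hs.nat_add_dvd_pow_add_pow P 1

/-! ### The main theorem -/

theorem mainTheorem2 {F : Type*} [Field F] [Fintype F] (p n k : ℕ) (hp : p.Prime) (hp2 : p ≠ 2)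
    (hF : Fintype.card F = p ^ n) (hnk : ¬ n ∣ k) :
    (Odd (k / n.gcd k) →
      differentialUniformity (fun x : F => x ^ ((p ^ k + 1) / 2)) = (p ^ n.gcd k - 1) / 2) ∧
    (Even (k / n.gcd k) →
      differentialUniformity (fun x : F => x ^ ((p ^ k + 1) / 2)) = p ^ n.gcd k + 1) ∧
    differentialUniformity (fun x : F => x ^ ((p ^ k + 1) / 2)) ≤
      Nat.gcd ((p ^ k - 1) / 2) (p ^ (2 * n) - 1) := by
  have := Fact.mk hp
  have : CharP F p := charP_of_card_eq_prime_pow hF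
  have hn : n ≠ 0 := by
    rintro rfl
    exact absurd hF Fintype.one_lt_card.ne'
  have hup := differentialUniformity_pow_half_le (F := F) hp2 k
  have hlow := fun N => gcd_le_differentialUniformity_pow_half (F := F) hp2 k (N := N)
  have hpn : 1 < p ^ n := Nat.one_lt_pow hn hp.one_lt
  rw [hF, show p ^ n - 1 + 2 = p ^ n + 1 by omega] at hup
  rw [hF, show p ^ n - 1 + 2 = p ^ n + 1 by omega] at hlow
  have he : 0 < n.gcd k := Nat.gcd_pos_of_pos_left k (Nat.pos_of_ne_zero hn)
  obtain ⟨s, hs⟩ := Nat.gcd_dvd_left n k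
  obtain ⟨t, ht⟩ := Nat.gcd_dvd_right n k
  have hpodd : Odd p := hp.odd_of_ne_two hp2
  obtain ⟨P, hPdef⟩ : ∃ P, P = p ^ n.gcd k := ⟨_, rfl⟩
  have hPn : p ^ n = P ^ s := by rw [hPdef, ← pow_mul, ← hs]
  have hPk : p ^ k = P ^ t := by rw [hPdef, ← pow_mul, ← ht]
  have hPodd : Odd P := hPdef ▸ hpodd.pow
  have hP1 : 1 < P := hPdef ▸ Nat.one_lt_pow he.ne' hp.one_lt
  have hkt : k / n.gcd k = t := Nat.div_eq_of_eq_mul_right he ht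
  have hst : s.Coprime t := by
    have := Nat.coprime_div_gcd_div_gcd (m := n) (n := k) he
    rwa [hkt, Nat.div_eq_of_eq_mul_right he hs] at this
  -- This is where `n ∤ k` enters; it yields the non-divisibility needed for the lower bounds.
  have hs1 : 1 < s := by
    have h0 : s ≠ 0 := fun h => hn (by rw [hs, h, mul_zero])
    have h1 : s ≠ 1 := fun h => hnk (by
      have : n = n.gcd k := by rw [h, mul_one] at hs; exact hs
      exact this ▸ Nat.gcd_dvd_right n k)
    omega
  have hPs : P < P ^ s := by simpa using Nat.pow_lt_pow_right hP1 hs1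
  rw [← hPdef, hkt]
  refine ⟨fun hodd => ?_, fun heven => ?_, ?_⟩
  · rw [hPn, hPk] at hup hlow
    rw [hPk]
    have hg := gcd_half_pow_sub_one_of_odd hPodd hodd hst
    have hc : 0 < (P - 1) / 2 := by
      obtain ⟨c, hc⟩ := hPodd
      omega
    refine le_antisymm (hup.trans (max_le hg.le (Nat.le_of_dvd hc ?_))) (hg ▸ hlow _ (Or.inl rfl) ?_)
    · refine dvd_half_of_dvd_half_pow_sub_one hPodd hodd hst (Nat.gcd_dvd_left _ _)
        ((Nat.gcd_dvd_right _ _).trans ?_)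
      exact pow_two_mul_sub_one P s ▸ Dvd.intro _ rfl
    · rw [two_mul_half_pow_sub_one hPodd]
      intro h
      have h' := Nat.pow_sub_one_gcd_pow_sub_one P s t
      rw [Nat.gcd_eq_left h, hst.gcd_eq_one, pow_one] at h'
      omega
  · rw [hPn, hPk] at hup hlow
    rw [hPk]
    have hg := gcd_half_pow_sub_one_of_even hPodd heven hst
    refine le_antisymm (hup.trans (max_le ?_ hg.le)) (hg ▸ hlow _ (Or.inr rfl) ?_)
    -- The other gcd divides `P - 1`, so it is smaller than `P + 1`.
    · have h' := Nat.pow_sub_one_gcd_pow_sub_one P t s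
      rw [hst.symm.gcd_eq_one, pow_one, ← two_mul_half_pow_sub_one hPodd t] at h'
      have hd : ((P ^ t - 1) / 2).gcd (P ^ s - 1) ∣ P - 1 :=
        h' ▸ Nat.gcd_dvd_gcd_mul_left_left _ _ _
      have := Nat.le_of_dvd (by omega) hd
      omega
    · rw [two_mul_half_pow_sub_one hPodd]
      intro h
      have := Nat.le_of_dvd (by omega) (dvd_add_one_of_dvd_pow (by omega) heven hst h dvd_rfl)
      omega
  -- Both `p^n - 1` and `p^n + 1` divide `p^(2n) - 1`.
  · have hfac := pow_two_mul_sub_one p n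
    have hpos : 0 < ((p ^ k - 1) / 2).gcd (p ^ (2 * n) - 1) :=
      Nat.gcd_pos_of_pos_right _ (by rw [hfac]; exact Nat.mul_pos (by omega) (by omega))
    refine hup.trans (max_le ?_ ?_) <;> refine Nat.le_of_dvd hpos ?_ <;> rw [hfac]
    · exact Nat.gcd_dvd_gcd_mul_left_right _ _ _
    · exact Nat.gcd_dvd_gcd_mul_right_right _ _ _
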